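/- There is an absolute constant $c>0$ such that the following holds. Let $d\ge 1$, let $\mathcal X\subset\mathbb R^d$ be a nonempty, closed, bounded, convex set with diameter $D=\sup_{x,y\in\mathcal X}\|x-y\|$ (Euclidean norm), let $T\ge 2$ and $L\ge 0$. Consider the following protocol for a loss $f$ and distributions $\mathcal D_1,\dots,\mathcal D_T$ on a measurable space $\Xi$, where $f(\cdot,\xi)$ is convex on $\mathcal X$ and differentiable at every point of $\mathcal X$ for every $\xi\in\Xi$: in round $t$ the learner chooses $x_t\in\mathcal X$, possibly at random, as a function of $f$, of $\xi_1,\dots,\xi_{t-1}$ and of its internal randomness; then $\xi_t\sim\mathcal D_t$ is drawn independently of the past and observed, and $g_t=\nabla f(x_t,\xi_t)$. Write $\nabla F_t(x)=\mathbb E_{\xi\sim\mathcal D_t}[\nabla f(x,\xi)]$ and $$\bar\sigma_T^2=\frac1T\sum_{t=1}^T\sup_{x\in\mathcal X}\mathbb E_{\xi\sim\mathcal D_t}\|\nabla f(x,\xi)-\nabla F_t(x)\|^2,\qquad \bar\Sigma_T^2=\frac1T\sum_{t=2}^T\sup_{x\in\mathcal X}\|\nabla F_t(x)-\nabla F_{t-1}(x)\|^2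 .$$ Then for every learner and every $\sigma,\Sigma>0$ there are a measurable space $\Xi$, a loss $f$ as above, a (deterministic) sequence of distributions $\mathcal D_1,\dots,\mathcal D_T$ on $\Xi$ and a number $G$ such that, for every $t\in\{1,\dots,T\}$: (A1) for $\mathcal D_t$-almost every $\xi$, $f(\cdot,\xi)$ is convex and $\|\nabla f(x,\xi)\|\le G$ for all $x\in\mathcal X$; (A2) the expected function $\mathbb E_{\xi\sim\mathcal D_t}[f(\cdot,\xi)]$ is well defined on $\mathcal X$ and its gradient $\nabla F_t$ is $L$-Lipschitz on $\mathcal X$; (A3) $\mathbb E_{\xi\sim\mathcal D_t}\|\nabla f(x,\xi)-\nabla F_t(x)\|^2<\infty$ for every $x\in\mathcal X$; and such that $\bar\sigma_T\ge\sigma$, $\bar\Sigma_T\ge\Sigma$ and, for some fixed $u\in\mathcal X$, the expected regret satisfies $$\mathbb E[R_T(u)]=\mathbb E\Big[\sum_{t=1}^T\langle g_t,x_t-u\rangle\Big]\;\ge\; c\,D\,(\bar\sigma_T+\bar\Sigma_T)\sqrt T .$$ -/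

import Mathlib

open MeasureTheory

namespace SEA

noncomputable section

/-- The gradient `∇f(x, ξ)` of `f(·, ξ)` at `x`. -/
def grad {d : ℕ} {Ξ : Type} (f : EuclideanSpace ℝ (Fin d) → Ξ → ℝ)
    (x : EuclideanSpace ℝ (Fin d)) (ξ : Ξ) : EuclideanSpace ℝ (Fin d) :=
  gradient (fun y => f y ξ) x

/-- A loss on `X × Ξ`: convex and differentiable in the decision at every point of `X`, with
measurable values and jointly measurable gradient. (The function may be defined on all of `ℝ^d`,
so that gradients at boundary points of `X` make sense.) -/
structure IsLoss {d : ℕ} {Ξ : Type} [MeasurableSpace Ξ] (X : Set (EuclideanSpace ℝ (Fin d)))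
    (f : EuclideanSpace ℝ (Fin d) → Ξ → ℝ) : Prop where
  convexOn : ∀ ξ, ConvexOn ℝ X (fun x => f x ξ)
  differentiableAt : ∀ ξ, ∀ x ∈ X, DifferentiableAt ℝ (fun y => f y ξ) x
  measurable : ∀ x ∈ X, Measurable (f x)
  measurable_grad : Measurable (fun p : X × Ξ => grad f p.1 p.2)

/-- A (possibly randomized) learner with decision set `X`. It draws an internal seed `ω ∼ P` before
the first round. It knows the loss `f`, and in the round with index `t` (rounds are numbered
`0, 1, 2, …`) it plays a point of `X` that depends measurably on the seed and on the samples
`ξ_0, …, ξ_{t-1}` observed so far (hence on the past losses `f(·, ξ_s)`, their gradients, and its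
own past decisions). -/
structure Learner.{u} {d : ℕ} (X : Set (EuclideanSpace ℝ (Fin d))) where
  Seed : Type u
  [seedSpace : MeasurableSpace Seed]
  P : ProbabilityMeasure Seed
  play : ∀ (Ξ : Type) [MeasurableSpace Ξ] (_ : EuclideanSpace ℝ (Fin d) → Ξ → ℝ) (t : ℕ),
    Seed → (Fin t → Ξ) → EuclideanSpace ℝ (Fin d)
  play_mem : ∀ (Ξ : Type) [MeasurableSpace Ξ] (f : EuclideanSpace ℝ (Fin d) → Ξ → ℝ),
    IsLoss X f → ∀ (t : ℕ) (ω : Seed) (h : Fin t → Ξ), play Ξ f t ω h ∈ X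
  measurable_play : ∀ (Ξ : Type) [MeasurableSpace Ξ] (f : EuclideanSpace ℝ (Fin d) → Ξ → ℝ),
    IsLoss X f → ∀ t : ℕ, Measurable (fun p : Seed × (Fin t → Ξ) => play Ξ f t p.1 p.2)

attribute [instance] Learner.seedSpace

section Distributions

variable {d : ℕ} {Ξ : Type} [MeasurableSpace Ξ]

/-- The gradient mean `∇F_𝒟(x) = E_{ξ ∼ 𝒟}[∇f(x, ξ)]`. -/
def meanGrad (f : EuclideanSpace ℝ (Fin d) → Ξ → ℝ) (𝒟 : ProbabilityMeasure Ξ)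
    (x : EuclideanSpace ℝ (Fin d)) : EuclideanSpace ℝ (Fin d) :=
  ∫ ξ, grad f x ξ ∂(𝒟 : Measure Ξ)

/-- `f(·, ξ)` is convex on `X` and its gradients on `X` are bounded by `G`, almost surely. -/
def AssumptionA1 (X : Set (EuclideanSpace ℝ (Fin d))) (f : EuclideanSpace ℝ (Fin d) → Ξ → ℝ)
    (𝒟 : ProbabilityMeasure Ξ) (G : ℝ) : Prop :=
  ∀ᵐ ξ ∂(𝒟 : Measure Ξ), ConvexOn ℝ X (fun x => f x ξ) ∧ ∀ x ∈ X, ‖grad f x ξ‖ ≤ G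

/-- The expected function exists on `X`, and its gradient `∇F_𝒟` is `L`-Lipschitz on `X`. -/
def AssumptionA2 (X : Set (EuclideanSpace ℝ (Fin d))) (f : EuclideanSpace ℝ (Fin d) → Ξ → ℝ)
    (𝒟 : ProbabilityMeasure Ξ) (L : NNReal) : Prop :=
  (∀ x ∈ X, Integrable (f x) (𝒟 : Measure Ξ)) ∧ LipschitzOnWith L (meanGrad f 𝒟) X

/-- The variance of the gradient is finite at every point of `X`. -/
def AssumptionA3 (X : Set (EuclideanSpace ℝ (Fin d))) (f : EuclideanSpace ℝ (Fin d) → Ξ → ℝ)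
    (𝒟 : ProbabilityMeasure Ξ) : Prop :=
  ∀ x ∈ X, Integrable (fun ξ => ‖grad f x ξ - meanGrad f 𝒟 x‖ ^ 2) (𝒟 : Measure Ξ)

/-- `σ_𝒟² = sup_{x ∈ X} E_{ξ ∼ 𝒟} ‖∇f(x, ξ) - ∇F_𝒟(x)‖²`
(a supremum of a bounded set when gradients are bounded). -/
def varSup (X : Set (EuclideanSpace ℝ (Fin d))) (f : EuclideanSpace ℝ (Fin d) → Ξ → ℝ)
    (𝒟 : ProbabilityMeasure Ξ) : ℝ :=
  ⨆ x : X, ∫ ξ, ‖grad f x ξ - meanGrad f 𝒟 x‖ ^ 2 ∂(𝒟 : Measure Ξ)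

/-- `sup_{x ∈ X} ‖∇F_𝒟(x) - ∇F_𝒟'(x)‖²`
(a supremum of a bounded set when gradients are bounded). -/
def driftSup (X : Set (EuclideanSpace ℝ (Fin d))) (f : EuclideanSpace ℝ (Fin d) → Ξ → ℝ)
    (𝒟 𝒟' : ProbabilityMeasure Ξ) : ℝ :=
  ⨆ x : X, ‖meanGrad f 𝒟 x - meanGrad f 𝒟' x‖ ^ 2

/-- `σ̄_T`, the root of the average stochastic variance, for a deterministic sequence of
distributions `𝒟 0, …, 𝒟 (T - 1)`. -/
def sigmaBar (X : Set (EuclideanSpace ℝ (Fin d))) (f : EuclideanSpace ℝ (Fin d) → Ξ → ℝ)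
    (𝒟 : ℕ → ProbabilityMeasure Ξ) (T : ℕ) : ℝ :=
  √((∑ t ∈ Finset.range T, varSup X f (𝒟 t)) / T)

/-- `Σ̄_T`, the root of the average adversarial variation, for a deterministic sequence of
distributions `𝒟 0, …, 𝒟 (T - 1)`. The first round has no predecessor and contributes `0`, so that
`Σ̄_T = 0` for a constant sequence. -/
def driftBar (X : Set (EuclideanSpace ℝ (Fin d))) (f : EuclideanSpace ℝ (Fin d) → Ξ → ℝ)
    (𝒟 : ℕ → ProbabilityMeasure Ξ) (T : ℕ) : ℝ :=
  √((∑ t ∈ Finset.range (T - 1), driftSup X f (𝒟 (t + 1)) (𝒟 t)) / T)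

variable {X : Set (EuclideanSpace ℝ (Fin d))}

/-- The joint law of the learner's seed and of the samples `ξ_0, …, ξ_{T-1}`, drawn independently
with `ξ_t ∼ 𝒟 t`. -/
def jointLaw (A : Learner X) (𝒟 : ℕ → ProbabilityMeasure Ξ) (T : ℕ) :
    Measure (A.Seed × (Fin T → Ξ)) :=
  (A.P : Measure A.Seed).prod (Measure.pi fun t : Fin T => (𝒟 t : Measure Ξ))

/-- The decision `x_t` of the learner when the seed is `ω` and the samples are `ξ`; it only sees
the samples of the rounds before `t`. -/
def decision (A : Learner X) (f : EuclideanSpace ℝ (Fin d) → Ξ → ℝ) {T : ℕ} (t : Fin T)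
    (ω : A.Seed) (ξ : Fin T → Ξ) : EuclideanSpace ℝ (Fin d) :=
  A.play Ξ f t ω (fun s : Fin (t : ℕ) => ξ (Fin.castLE t.isLt.le s))

/-- The regret `R_T(u) = ∑_t ⟨g_t, x_t - u⟩` with `g_t = ∇f(x_t, ξ_t)`. -/
def regret (A : Learner X) (f : EuclideanSpace ℝ (Fin d) → Ξ → ℝ) (T : ℕ)
    (u : EuclideanSpace ℝ (Fin d)) (p : A.Seed × (Fin T → Ξ)) : ℝ :=
  ∑ t : Fin T, inner ℝ (grad f (decision A f t p.1 p.2) (p.2 t)) (decision A f t p.1 p.2 - u)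

end Distributions

end

end SEA

/-!
Along a diameter of `X` with unit direction `e`, the losses are linear with gradient `± M e`, the
sign of round `t` being random with mean `m t`. Since the gradients do not depend on the decision,
the suprema in `σ̄_T` and `Σ̄_T` are trivial, every `∇F_t` is constant (so any Lipschitz constant is
allowed), and all that is left to choose is the scale `M` and the sequence `m`. With `|m t|`
alternating between `1/4` and `1/2`, both `σ̄_T` and `Σ̄_T` lie between `M / 6` and `M` whatever the
signs of `m` (`sigmaBar_signLoss_mem`, `driftBar_signLoss_mem`), so that a large `M` makes them
exceed the prescribed values while their sum stays at most `2 M`.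

The sample of round `t` is independent of what the learner has seen before
(`measurePreserving_history_sample`), so the expected regret against `u` is `M ∑ m t (Y t - ⟨e, u⟩)`,
where `Y t` is the mean of `⟨e, x_t⟩` and depends on `m` only through `m 0, …, m (t - 1)`
(`regret_signLoss`). If `u` is the better of the two ends of the diameter, this equals
`M (∑ m t y t + (D / 2) |∑ m t|)`, with `y t` the offset of `Y t` from the midpoint. For uniformly
random signs of `m` the first sum would have mean zero and the second, by Khintchine's inequality,
mean of order `√T`, so some deterministic choice of signs is at least as good. These signs are
constructed one at a time with a potential (`exists_signs_payoff_ge`): the bound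
`|s| ≥ s² / q - s⁴ / (6 q³)` replaces the modulus by a quartic polynomial, whose conditional
expectations given the first signs are explicit up to an error of favourable sign.
-/

open ProbabilityTheory

namespace SEA

/-! ### The sign game -/

/-- One step of the averaging argument for the quartic potential
`A (s² + Q) - B (s⁴ + 6 s² Q + 3 Q²)`, where `s` is the current sum and `Q` the sum of the squares
of the remaining increments: its mean over `s ± a` (with `Q` decreased by `a²`) does not decrease,
so one of the two signs compensates the linear payoff `± a y`. -/
lemma exists_sign_potential_le {K A B a s Q y : ℝ} (hK : 0 ≤ K) (hB : 0 ≤ B) :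
    ∃ m : ℝ, (m = a ∨ m = -a) ∧
      K * (A * (s ^ 2 + (Q + a ^ 2)) -
          B * (s ^ 4 + 6 * s ^ 2 * (Q + a ^ 2) + 3 * (Q + a ^ 2) ^ 2)) ≤
        m * y + K * (A * ((s + m) ^ 2 + Q) -
          B * ((s + m) ^ 4 + 6 * (s + m) ^ 2 * Q + 3 * Q ^ 2)) := by
  by_contra! h
  have h1 := h a (.inl rfl)
  have h2 := h (-a) (.inr rfl)
  have h3 : 0 ≤ K * (B * a ^ 4) := by positivity
  nlinarith

/-- Against payoffs `y t` that depend only on the earlier increments, the signs of the increments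
`± a t` can be chosen so that the payoff plus `K` times the modulus of the final sum is of the order
`K √(∑ a²)`. This is the lower Khintchine inequality, derandomized. -/
lemma exists_signs_payoff_ge (T : ℕ) (a : ℕ → ℝ) (y : ℕ → (ℕ → ℝ) → ℝ)
    (hy : ∀ t m m', (∀ s < t, m s = m' s) → y t m = y t m') {K : ℝ} (hK : 0 ≤ K)
    (hQ : 0 < ∑ t ∈ Finset.range T, a t ^ 2) :
    ∃ m : ℕ → ℝ, (∀ t, m t = a t ∨ m t = -a t) ∧
      K / 2 * √(∑ t ∈ Finset.range T, a t ^ 2) ≤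
        ∑ t ∈ Finset.range T, m t * y t m + K * |∑ t ∈ Finset.range T, m t| := by
  set q := √(∑ t ∈ Finset.range T, a t ^ 2) with hq
  have hq0 : 0 < q := Real.sqrt_pos.2 hQ
  have hqq : ∑ t ∈ Finset.range T, a t ^ 2 = q ^ 2 := (Real.sq_sqrt hQ.le).symm
  -- `|s| ≥ s² / q - s⁴ / (6 q³)`, because `x - x³ / 6 ≤ 1` for `x ≥ 0`.
  let Φ : ℝ → ℝ → ℝ := fun s Q =>
    1 / q * (s ^ 2 + Q) - 1 / (6 * q ^ 3) * (s ^ 4 + 6 * s ^ 2 * Q + 3 * Q ^ 2)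
  have key : ∀ n ≤ T, ∃ m : ℕ → ℝ, (∀ t, m t = a t ∨ m t = -a t) ∧
      K * Φ 0 (q ^ 2) ≤ ∑ t ∈ Finset.range n, m t * y t m +
        K * Φ (∑ t ∈ Finset.range n, m t) (q ^ 2 - ∑ t ∈ Finset.range n, a t ^ 2) := by
    intro n
    induction n with
    | zero => exact fun _ => ⟨a, fun t => .inl rfl, by simp⟩
    | succ n ih =>
      intro hn
      obtain ⟨m, hm, hle⟩ := ih (by omega)
      obtain ⟨b, hb, hb'⟩ := exists_sign_potential_le (K := K) (A := 1 / q) (B := 1 / (6 * q ^ 3))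
        (a := a n) (s := ∑ t ∈ Finset.range n, m t)
        (Q := q ^ 2 - ∑ t ∈ Finset.range (n + 1), a t ^ 2) (y := y n m) hK (by positivity)
      have hup : ∀ t < n, Function.update m n b t = m t := fun t ht =>
        Function.update_of_ne ht.ne _ _
      refine ⟨Function.update m n b, fun t => ?_, ?_⟩
      · by_cases h : t = n
        · subst h; simpa using hb
        · simpa [h] using hm t
      · have e1 : ∑ t ∈ Finset.range n, Function.update m n b t * y t (Function.update m n b) =
            ∑ t ∈ Finset.range n, m t * y t m := Finset.sum_congr rfl fun t ht => by
          rw [Finset.mem_range] at ht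
          rw [hup t ht, hy t _ m fun s hs => hup s (hs.trans ht)]
        have e2 : ∑ t ∈ Finset.range n, Function.update m n b t = ∑ t ∈ Finset.range n, m t :=
          Finset.sum_congr rfl fun t ht => hup t (Finset.mem_range.1 ht)
        have e3 : q ^ 2 - ∑ t ∈ Finset.range n, a t ^ 2 =
            q ^ 2 - ∑ t ∈ Finset.range (n + 1), a t ^ 2 + a n ^ 2 := by
          rw [Finset.sum_range_succ]; ring
        rw [e3] at hle
        rw [Finset.sum_range_succ (fun t => _ * _), Finset.sum_range_succ (Function.update m n b),
          e1, e2, hy n _ m hup, Function.update_self]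
        simp only [Φ] at hle ⊢
        linarith
  obtain ⟨m, hm, hle⟩ := key T le_rfl
  refine ⟨m, hm, ?_⟩
  rw [hqq, sub_self] at hle
  have h0 : Φ 0 (q ^ 2) = q / 2 := by
    simp only [Φ]; field_simp; ring
  have habs : ∀ s : ℝ, Φ s 0 ≤ |s| := by
    intro s
    have hx : 0 ≤ |s| / q := by positivity
    have hs : Φ s 0 = |s| * (|s| / q - (|s| / q) ^ 3 / 6) := by
      have h4 : s ^ 4 = |s| ^ 4 := by rw [show (4 : ℕ) = 2 * 2 from rfl, pow_mul, pow_mul, sq_abs]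
      simp only [Φ]
      rw [h4, ← sq_abs s]
      field_simp
      ring
    rw [hs]
    refine mul_le_of_le_one_right (abs_nonneg s) ?_
    generalize |s| / q = x at hx
    nlinarith [mul_nonneg hx (sq_nonneg (x - 3 / 2)), sq_nonneg (x - 3 / 2), sq_nonneg (x - 1)]
  rw [h0] at hle
  have := mul_le_mul_of_nonneg_left (habs (∑ t ∈ Finset.range T, m t)) hK
  linarith

/-! ### The interaction of a learner with independent samples -/

/-- Under a product measure, the coordinates before `t` and the coordinate `t` are independent with
their own product laws. -/
lemma measurePreserving_prefix_eval {Ξ : Type*} [MeasurableSpace Ξ] (μ : ℕ → Measure Ξ)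
    [∀ t, IsProbabilityMeasure (μ t)] {T : ℕ} (t : Fin T) :
    MeasurePreserving
      (fun ξ : Fin T → Ξ => ((fun s : Fin (t : ℕ) => ξ (Fin.castLE t.isLt.le s)), ξ t))
      (.pi fun i : Fin T => μ i) ((Measure.pi fun i : Fin (t : ℕ) => μ i).prod (μ t)) := by
  have hle : (t : ℕ) + 1 ≤ T := t.isLt
  -- Forgetting the coordinates after `t` maps the product law to the shorter product law.
  have hres : MeasurePreserving
      (fun (ξ : Fin T → Ξ) (s : Fin ((t : ℕ) + 1)) => ξ (Fin.castLE hle s))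
      (.pi fun i : Fin T => μ i) (.pi fun i : Fin ((t : ℕ) + 1) => μ i) := by
    refine ⟨by fun_prop, (Measure.pi_eq fun s hs => ?_).symm⟩
    have hinj := Fin.castLE_injective hle
    rw [Measure.map_apply (by fun_prop) (.univ_pi hs)]
    have hpre : (fun (ξ : Fin T → Ξ) (s : Fin ((t : ℕ) + 1)) => ξ (Fin.castLE hle s)) ⁻¹'
        Set.univ.pi s =
        Set.univ.pi (Function.extend (Fin.castLE hle) s fun _ => Set.univ) := by
      ext ξ
      simp only [Set.mem_preimage, Set.mem_pi, Set.mem_univ, true_imp_iff]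
      refine ⟨fun h j => ?_, fun h i => by simpa [hinj.extend_apply] using h (Fin.castLE hle i)⟩
      by_cases hj : ∃ i, Fin.castLE hle i = j
      · obtain ⟨i, rfl⟩ := hj
        rw [hinj.extend_apply]
        exact h i
      · rw [Function.extend_apply' _ _ _ hj]
        trivial
    rw [hpre, Measure.pi_pi]
    symm
    refine Fintype.prod_of_injective _ hinj _ _ (fun j hj => ?_) fun i => ?_
    · rw [Function.extend_apply' _ _ _ hj, measure_univ]
    · rw [hinj.extend_apply, Fin.val_castLE]
  have hlast := measurePreserving_piFinSuccAbove (fun i : Fin ((t : ℕ) + 1) => μ i) (Fin.last t)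
  simp only [Fin.succAbove_last, Fin.val_last, Fin.val_castSucc] at hlast
  convert Measure.measurePreserving_swap.comp (hlast.comp hres) using 1
  funext ξ
  refine Prod.ext (funext fun s => ?_) rfl
  simp [MeasurableEquiv.piFinSuccAbove, Fin.init]

section Interaction

variable {d : ℕ} {Ξ : Type} [MeasurableSpace Ξ] {X : Set (EuclideanSpace ℝ (Fin d))}

instance (A : Learner X) (𝒟 : ℕ → ProbabilityMeasure Ξ) (T : ℕ) :
    IsProbabilityMeasure (jointLaw A 𝒟 T) := by
  unfold jointLaw; infer_instance

/-- What the learner has seen before round `t` is independent of the sample of round `t`. -/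
lemma measurePreserving_history_sample (A : Learner X) (𝒟 : ℕ → ProbabilityMeasure Ξ) {T : ℕ}
    (t : Fin T) :
    MeasurePreserving
      (fun p : A.Seed × (Fin T → Ξ) =>
        ((p.1, fun s : Fin (t : ℕ) => p.2 (Fin.castLE t.isLt.le s)), p.2 t))
      (jointLaw A 𝒟 T) ((jointLaw A 𝒟 t).prod (𝒟 t : Measure Ξ)) := by
  have h := (MeasurePreserving.id (A.P : Measure A.Seed)).prod
    (measurePreserving_prefix_eval (fun t => (𝒟 t : Measure Ξ)) t)
  exact ((measurePreserving_prodAssoc _ _ _).symm MeasurableEquiv.prodAssoc).comp h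

lemma measurable_decision (A : Learner X) {f : EuclideanSpace ℝ (Fin d) → Ξ → ℝ}
    (hf : IsLoss X f) {T : ℕ} (t : Fin T) :
    Measurable fun p : A.Seed × (Fin T → Ξ) => decision A f t p.1 p.2 :=
  (A.measurable_play Ξ f hf t).comp
    (g := fun p : A.Seed × (Fin t → Ξ) => A.play Ξ f t p.1 p.2)
    (f := fun p : A.Seed × (Fin T → Ξ) =>
      (p.1, fun s : Fin (t : ℕ) => p.2 (Fin.castLE t.isLt.le s))) (by fun_prop)

/-- Functions of the sample and of the decision of one round are uncorrelated. -/
lemma integral_sample_mul_decision (A : Learner X) {f : EuclideanSpace ℝ (Fin d) → Ξ → ℝ}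
    (hf : IsLoss X f) (𝒟 : ℕ → ProbabilityMeasure Ξ) {T : ℕ} (t : Fin T) {r : Ξ → ℝ}
    (hr : Measurable r) {φ : EuclideanSpace ℝ (Fin d) → ℝ} (hφ : Measurable φ) :
    ∫ p, r (p.2 t) * φ (decision A f t p.1 p.2) ∂jointLaw A 𝒟 T =
      (∫ ξ, r ξ ∂(𝒟 t : Measure Ξ)) * ∫ p, φ (A.play Ξ f t p.1 p.2) ∂jointLaw A 𝒟 t := by
  have hmp := measurePreserving_history_sample A 𝒟 t
  have hplay := hφ.comp (A.measurable_play Ξ f hf t)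
  rw [mul_comm, ← integral_prod_mul (fun p : A.Seed × (Fin t → Ξ) => φ (A.play Ξ f t p.1 p.2)) r,
    ← hmp.map_eq, integral_map hmp.measurable.aemeasurable]
  · simp only [mul_comm, decision]
  · exact ((hplay.comp measurable_fst).mul (hr.comp measurable_snd)).aestronglyMeasurable

/-- The law of the interaction before round `t` involves only the distributions of the rounds
before `t`. -/
lemma jointLaw_congr (A : Learner X) {𝒟 𝒟' : ℕ → ProbabilityMeasure Ξ} {t : ℕ}
    (h : ∀ s < t, 𝒟 s = 𝒟' s) : jointLaw A 𝒟 t = jointLaw A 𝒟' t := by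
  unfold jointLaw
  congr 2
  funext s
  rw [h s s.isLt]

end Interaction

/-! ### Linear losses with random signs -/

/-- The sign encoded by a Boolean. -/
def boolSign (b : Bool) : ℝ := if b then 1 else -1

/-- The law on `Bool` whose sign has mean `m`, for `m ∈ [-1, 1]`. Other values of `m` are moved to
the nearer endpoint, so that the law is defined for every real `m`. -/
noncomputable def signLaw (m : ℝ) : ProbabilityMeasure Bool :=
  ⟨bernoulliMeasure true false (Set.projIcc 0 1 zero_le_one ((1 + m) / 2)), inferInstance⟩

lemma integrable_signLaw {E : Type*} [NormedAddCommGroup E] (m : ℝ) (g : Bool → E) :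
    Integrable g (signLaw m : Measure Bool) :=
  integrable_bernoulliMeasure ..

lemma integral_signLaw {E : Type*} [NormedAddCommGroup E] [NormedSpace ℝ E] [CompleteSpace E]
    {m : ℝ} (hm : |m| ≤ 1) (g : Bool → E) :
    ∫ b, g b ∂(signLaw m : Measure Bool) =
      ((1 + m) / 2) • g true + ((1 - m) / 2) • g false := by
  have h := abs_le.1 hm
  have hI : (1 + m) / 2 ∈ Set.Icc (0 : ℝ) 1 := ⟨by linarith, by linarith⟩
  change ∫ b, g b ∂(bernoulliMeasure true false _) = _
  rw [integral_bernoulliMeasure, Set.projIcc_of_mem _ hI]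
  simp
  congr 1
  ring

/-- The linear loss with gradient `± M e`, the sign being the sample. -/
noncomputable def signLoss {d : ℕ} (M : ℝ) (e : EuclideanSpace ℝ (Fin d))
    (x : EuclideanSpace ℝ (Fin d)) (b : Bool) : ℝ :=
  inner ℝ ((boolSign b * M) • e) x

section SignLoss

variable {d : ℕ} (M : ℝ) (e : EuclideanSpace ℝ (Fin d)) (X : Set (EuclideanSpace ℝ (Fin d)))

lemma hasGradientAt_signLoss (x : EuclideanSpace ℝ (Fin d)) (b : Bool) :
    HasGradientAt (fun y => signLoss M e y b) ((boolSign b * M) • e) x :=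
  (InnerProductSpace.toDual ℝ _ ((boolSign b * M) • e)).hasFDerivAt

@[simp]
lemma grad_signLoss (x : EuclideanSpace ℝ (Fin d)) (b : Bool) :
    grad (signLoss M e) x b = (boolSign b * M) • e :=
  (hasGradientAt_signLoss M e x b).gradient

lemma isLoss_signLoss (hX : Convex ℝ X) : IsLoss X (signLoss M e) where
  convexOn b := (innerₛₗ ℝ ((boolSign b * M) • e)).convexOn hX
  differentiableAt b x _ := (hasGradientAt_signLoss M e x b).differentiableAt
  measurable _ _ := measurable_of_countable _
  measurable_grad := by
    simp only [grad_signLoss]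
    exact (measurable_of_countable fun b => (boolSign b * M) • e).comp measurable_snd

variable {M e X} {m : ℝ}

lemma meanGrad_signLoss (hm : |m| ≤ 1) (x : EuclideanSpace ℝ (Fin d)) :
    meanGrad (signLoss M e) (signLaw m) x = (m * M) • e := by
  simp only [meanGrad, grad_signLoss]
  rw [integral_signLaw hm]
  simp only [boolSign, smul_smul, ← add_smul]
  congr 1
  simp
  ring

lemma varSup_signLoss (hX : X.Nonempty) (he : ‖e‖ = 1) (hm : |m| ≤ 1) :
    varSup X (signLoss M e) (signLaw m) = (1 - m ^ 2) * M ^ 2 := by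
  have := hX.to_subtype
  simp only [varSup, grad_signLoss, meanGrad_signLoss hm, ← sub_smul, norm_smul, he, mul_one,
    Real.norm_eq_abs, sq_abs, integral_signLaw hm, ciSup_const]
  simp [boolSign]
  ring

lemma driftSup_signLoss {m' : ℝ} (hX : X.Nonempty) (he : ‖e‖ = 1) (hm : |m| ≤ 1)
    (hm' : |m'| ≤ 1) :
    driftSup X (signLoss M e) (signLaw m) (signLaw m') = (m - m') ^ 2 * M ^ 2 := by
  have := hX.to_subtype
  simp only [driftSup, meanGrad_signLoss hm, meanGrad_signLoss hm', ← sub_smul, norm_smul, he,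
    mul_one, Real.norm_eq_abs, sq_abs, ciSup_const]
  ring

lemma assumptionA1_signLoss (hX : Convex ℝ X) (he : ‖e‖ = 1) :
    AssumptionA1 X (signLoss M e) (signLaw m) |M| := by
  refine .of_forall fun b => ⟨(isLoss_signLoss M e X hX).convexOn b, fun x _ => ?_⟩
  cases b <;> simp [boolSign, norm_smul, he]

lemma assumptionA2_signLoss (hm : |m| ≤ 1) (L : NNReal) :
    AssumptionA2 X (signLoss M e) (signLaw m) L :=
  ⟨fun _ _ => integrable_signLaw _ _, fun x _ y _ => by simp [meanGrad_signLoss hm]⟩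

lemma assumptionA3_signLoss : AssumptionA3 X (signLoss M e) (signLaw m) :=
  fun _ _ => integrable_signLaw _ _

/-- The regret is integrable, and its mean splits into the linear payoffs of the rounds. -/
lemma regret_signLoss (hX : Convex ℝ X) (hb : Bornology.IsBounded X) (A : Learner X) {m : ℕ → ℝ}
    (hm : ∀ t, |m t| ≤ 1) (T : ℕ) (u : EuclideanSpace ℝ (Fin d)) :
    Integrable (regret A (signLoss M e) T u) (jointLaw A (fun t => signLaw (m t)) T) ∧
      ∫ p, regret A (signLoss M e) T u p ∂jointLaw A (fun t => signLaw (m t)) T =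
        M * ∑ t ∈ Finset.range T, m t * ((∫ p, inner ℝ e (A.play Bool (signLoss M e) t p.1 p.2)
          ∂jointLaw A (fun t => signLaw (m t)) t) - inner ℝ e u) := by
  have hf := isLoss_signLoss M e X hX
  obtain ⟨R, hR⟩ := hb.exists_norm_le
  have hint : ∀ t : Fin T, Integrable (fun p : A.Seed × (Fin T → Bool) =>
      (boolSign (p.2 t) * M) * inner ℝ e (decision A (signLoss M e) t p.1 p.2 - u))
      (jointLaw A (fun t => signLaw (m t)) T) := fun t => by
    have hd := measurable_decision A hf t
    have hs : Measurable boolSign := measurable_of_countable _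
    refine .of_bound (C := |M| * (‖e‖ * (R + ‖u‖))) (by fun_prop) (.of_forall fun p => ?_)
    have hx : ‖decision A (signLoss M e) t p.1 p.2‖ ≤ R := hR _ (A.play_mem _ _ hf _ _ _)
    have hsign : |boolSign (p.2 t)| = 1 := by cases p.2 t <;> simp [boolSign]
    rw [Real.norm_eq_abs, abs_mul, abs_mul, hsign, one_mul]
    gcongr
    exact (abs_real_inner_le_norm _ _).trans
      (by gcongr; exact (norm_sub_le _ _).trans (by gcongr))
  have hreg : regret A (signLoss M e) T u = fun p => ∑ t : Fin T,
      (boolSign (p.2 t) * M) * inner ℝ e (decision A (signLoss M e) t p.1 p.2 - u) := by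
    funext p
    simp [regret, real_inner_smul_left]
  rw [hreg]
  refine ⟨integrable_finsetSum _ fun t _ => hint t, ?_⟩
  rw [integral_finsetSum _ fun t _ => hint t, Finset.mul_sum, ← Fin.sum_univ_eq_sum_range
    (fun t => M * (m t * ((∫ p, inner ℝ e (A.play Bool (signLoss M e) t p.1 p.2)
          ∂jointLaw A (fun t => signLaw (m t)) t) - inner ℝ e u)))]
  refine Finset.sum_congr rfl fun t _ => ?_
  rw [integral_sample_mul_decision A hf _ t (r := fun b => boolSign b * M)
    (φ := fun x => inner ℝ e (x - u)) (measurable_of_countable _) (by fun_prop),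
    integral_signLaw (hm t)]
  have hplay : Integrable (fun p : A.Seed × (Fin t → Bool) =>
      inner ℝ e (A.play Bool (signLoss M e) t p.1 p.2))
      (jointLaw A (fun t => signLaw (m t)) t) := by
    have hd := A.measurable_play Bool _ hf t
    refine .of_bound (C := ‖e‖ * R) (by fun_prop) (.of_forall fun p => ?_)
    exact (abs_real_inner_le_norm _ _).trans
      (by gcongr; exact hR _ (A.play_mem _ _ hf _ _ _))
  simp only [inner_sub_right]
  rw [integral_sub hplay (integrable_const _)]
  simp [boolSign]
  ring

end SignLoss

/-! ### The lower bound -/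

/-- A diameter of a compact set: two of its points and a unit vector along their difference. The
unit vector is arbitrary when the set is a single point. -/
lemma exists_unit_diam {E : Type*} [NormedAddCommGroup E] [NormedSpace ℝ E] [Nontrivial E]
    {X : Set E} (hne : X.Nonempty) (hX : IsCompact X) :
    ∃ a ∈ X, ∃ b ∈ X, ∃ e : E, ‖e‖ = 1 ∧ a - b = Metric.diam X • e := by
  obtain ⟨⟨a, b⟩, ⟨ha, hb⟩, hmax⟩ := (hX.prod hX).exists_isMaxOn (hne.prod hne)
    continuous_dist.continuousOn
  have hdiam : Metric.diam X = ‖a - b‖ := by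
    rw [← dist_eq_norm]
    exact le_antisymm
      (Metric.diam_le_of_forall_dist_le dist_nonneg fun x hx y hy => hmax (Set.mk_mem_prod hx hy))
      (Metric.dist_le_diam_of_mem hX.isBounded ha hb)
  refine ⟨a, ha, b, hb, ?_⟩
  rw [hdiam]
  by_cases h : a - b = 0
  · obtain ⟨e, he⟩ := exists_norm_eq E zero_le_one
    exact ⟨e, he, by rw [h, norm_zero, zero_smul]⟩
  · refine ⟨‖a - b‖⁻¹ • (a - b), norm_smul_inv_norm h, ?_⟩
    rw [smul_smul, mul_inv_cancel₀ (norm_ne_zero_iff.2 h), one_smul]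

/-- The moduli `1/4, 1/2, 1/4, …` of the mean signs. They alternate so that consecutive mean
gradients differ whatever the signs, and stay at most `1/2` so that the variance remains of the
order of its maximum. -/
noncomputable def signBias (t : ℕ) : ℝ := if Even t then 1 / 4 else 1 / 2

lemma signBias_mem (t : ℕ) : signBias t = 1 / 4 ∨ signBias t = 1 / 2 := by
  unfold signBias; split_ifs <;> simp

lemma abs_le_half_of_signBias {m : ℕ → ℝ} (hm : ∀ t, m t = signBias t ∨ m t = -signBias t)
    (t : ℕ) : |m t| ≤ 1 / 2 := by
  rcases hm t with h | h <;> rcases signBias_mem t with h' | h' <;> rw [h, h', abs_le] <;>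
    norm_num

lemma sq_sub_mem_of_signBias {m : ℕ → ℝ} (hm : ∀ t, m t = signBias t ∨ m t = -signBias t)
    (t : ℕ) : (m (t + 1) - m t) ^ 2 ∈ Set.Icc (1 / 16 : ℝ) 1 := by
  rcases hm t with h | h <;> rcases hm (t + 1) with h' | h' <;> rw [h, h'] <;>
    by_cases ht : Even t <;> simp only [signBias, ht, Nat.even_add_one] <;> norm_num

/-- Since `|m t| ≤ 1/2`, each round has variance between `3 M² / 4` and `M²`. -/
lemma sigmaBar_signLoss_mem {d : ℕ} {X : Set (EuclideanSpace ℝ (Fin d))}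
    {e : EuclideanSpace ℝ (Fin d)} {M : ℝ} {T : ℕ} {m : ℕ → ℝ}
    (hm : ∀ t, m t = signBias t ∨ m t = -signBias t)
    (hX : X.Nonempty) (he : ‖e‖ = 1) (hM : 0 ≤ M) (hT : 2 ≤ T) :
    sigmaBar X (signLoss M e) (fun t => signLaw (m t)) T ∈ Set.Icc (M / 2) M := by
  have hT' : (0 : ℝ) < T := by positivity
  have h1 : ∀ t, |m t| ≤ 1 := fun t => (abs_le_half_of_signBias hm t).trans (by norm_num)
  have hsq : ∀ t, m t ^ 2 ≤ 1 / 4 := fun t => by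
    rw [← sq_abs]
    nlinarith [abs_le_half_of_signBias hm t, abs_nonneg (m t)]
  simp only [sigmaBar, varSup_signLoss hX he (h1 _)]
  refine ⟨Real.le_sqrt_of_sq_le ((le_div_iff₀ hT').2 ?_),
    Real.sqrt_le_iff.2 ⟨hM, (div_le_iff₀ hT').2 ?_⟩⟩
  · have := Finset.card_nsmul_le_sum (Finset.range T) (fun t => (1 - m t ^ 2) * M ^ 2)
      ((M / 2) ^ 2) fun t _ => by nlinarith [hsq t, sq_nonneg M]
    simpa [mul_comm] using this
  · have := Finset.sum_le_card_nsmul (Finset.range T) (fun t => (1 - m t ^ 2) * M ^ 2)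
      (M ^ 2) fun t _ => by nlinarith [sq_nonneg (m t), sq_nonneg M]
    simpa [mul_comm] using this

/-- The missing drift of the first round costs at most a factor `(T - 1) / T ≥ 1 / 2`. -/
lemma driftBar_signLoss_mem {d : ℕ} {X : Set (EuclideanSpace ℝ (Fin d))}
    {e : EuclideanSpace ℝ (Fin d)} {M : ℝ} {T : ℕ} {m : ℕ → ℝ}
    (hm : ∀ t, m t = signBias t ∨ m t = -signBias t)
    (hX : X.Nonempty) (he : ‖e‖ = 1) (hM : 0 ≤ M) (hT : 2 ≤ T) :
    driftBar X (signLoss M e) (fun t => signLaw (m t)) T ∈ Set.Icc (M / 6) M := by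
  have hT' : (2 : ℝ) ≤ T := by exact_mod_cast hT
  have hT0 : (0 : ℝ) < T := by linarith
  have h1 : ∀ t, |m t| ≤ 1 := fun t => (abs_le_half_of_signBias hm t).trans (by norm_num)
  have hcast : ((T - 1 : ℕ) : ℝ) = T - 1 := by rw [Nat.cast_sub (by omega), Nat.cast_one]
  simp only [driftBar, driftSup_signLoss hX he (h1 _) (h1 _)]
  refine ⟨Real.le_sqrt_of_sq_le ((le_div_iff₀ hT0).2 ?_),
    Real.sqrt_le_iff.2 ⟨hM, (div_le_iff₀ hT0).2 ?_⟩⟩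
  · have := Finset.card_nsmul_le_sum (Finset.range (T - 1))
      (fun t => (m (t + 1) - m t) ^ 2 * M ^ 2) (1 / 16 * M ^ 2) fun t _ => by
        gcongr; exact (sq_sub_mem_of_signBias hm t).1
    rw [Finset.card_range, nsmul_eq_mul, hcast] at this
    nlinarith [sq_nonneg M]
  · have := Finset.sum_le_card_nsmul (Finset.range (T - 1))
      (fun t => (m (t + 1) - m t) ^ 2 * M ^ 2) (1 * M ^ 2) fun t _ => by
        gcongr; exact (sq_sub_mem_of_signBias hm t).2
    rw [Finset.card_range, nsmul_eq_mul, hcast] at this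
    nlinarith [sq_nonneg M]

end SEA

theorem theorem2 :
    ∃ c : ℝ, 0 < c ∧
      ∀ (d : ℕ) (_ : 1 ≤ d) (X : Set (EuclideanSpace ℝ (Fin d)))
        (_ : X.Nonempty) (_ : IsClosed X) (_ : Bornology.IsBounded X) (_ : Convex ℝ X)
        (T : ℕ) (_ : 2 ≤ T) (L : NNReal) (A : SEA.Learner X)
        (σ S : ℝ) (_ : 0 < σ) (_ : 0 < S),
      ∃ (Ξ : Type) (_ : MeasurableSpace Ξ) (f : EuclideanSpace ℝ (Fin d) → Ξ → ℝ)
        (𝒟 : ℕ → ProbabilityMeasure Ξ) (G : ℝ),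
        SEA.IsLoss X f ∧
        (∀ t < T, SEA.AssumptionA1 X f (𝒟 t) G ∧ SEA.AssumptionA2 X f (𝒟 t) L ∧
          SEA.AssumptionA3 X f (𝒟 t)) ∧
        σ ≤ SEA.sigmaBar X f 𝒟 T ∧
        S ≤ SEA.driftBar X f 𝒟 T ∧
        ∃ u ∈ X,
          Integrable (SEA.regret A f T u) (SEA.jointLaw A 𝒟 T) ∧
          c * (Metric.diam X * (SEA.sigmaBar X f 𝒟 T + SEA.driftBar X f 𝒟 T) * √T) ≤
            ∫ p, SEA.regret A f T u p ∂(SEA.jointLaw A 𝒟 T) := by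
  refine ⟨1 / 32, by norm_num, ?_⟩
  intro d hd X hne hcl hb hX T hT L A σ S hσ hS
  have : Nonempty (Fin d) := ⟨⟨0, hd⟩⟩
  obtain ⟨a, ha, b, hb', e, he, hab⟩ :=
    SEA.exists_unit_diam hne (Metric.isCompact_of_isClosed_isBounded hcl hb)
  set D := Metric.diam X with hD
  have hD0 : 0 ≤ D := Metric.diam_nonneg
  set M := 2 * σ + 6 * S with hM
  have hM0 : 0 < M := by positivity
  have heab : inner ℝ e a - inner ℝ e b = D := by
    rw [← inner_sub_right, hab, real_inner_smul_right, real_inner_self_eq_norm_sq, he]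
    ring
  -- The mean position of the learner along `e` in round `t`, measured from the midpoint of `a` and
  -- `b`, depends only on the laws of the rounds before `t`.
  obtain ⟨m, hm, hgame⟩ := SEA.exists_signs_payoff_ge T SEA.signBias
    (fun t m => (∫ p, inner ℝ e (A.play Bool (SEA.signLoss M e) t p.1 p.2)
      ∂SEA.jointLaw A (fun t => SEA.signLaw (m t)) t) - (inner ℝ e a + inner ℝ e b) / 2)
    (fun t m m' h => by
      rw [SEA.jointLaw_congr A (𝒟' := fun t => SEA.signLaw (m' t)) fun s hs => by rw [h s hs]])
    (K := D / 2) (by positivity)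
    (Finset.sum_pos (fun t _ => by rcases SEA.signBias_mem t with h | h <;> rw [h] <;> norm_num)
      (Finset.nonempty_range_iff.2 (by omega)))
  have hm1 : ∀ t, |m t| ≤ 1 := fun t =>
    (SEA.abs_le_half_of_signBias hm t).trans (by norm_num)
  have hσ' := SEA.sigmaBar_signLoss_mem hm hne he hM0.le hT
  have hS' := SEA.driftBar_signLoss_mem hm hne he hM0.le hT
  have hQ : √T / 4 ≤ √(∑ t ∈ Finset.range T, SEA.signBias t ^ 2) := by
    refine Real.le_sqrt_of_sq_le ?_
    have := Finset.card_nsmul_le_sum (Finset.range T) (fun t => SEA.signBias t ^ 2) (1 / 16)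
      fun t _ => by rcases SEA.signBias_mem t with h | h <;> rw [h] <;> norm_num
    rw [Finset.card_range, nsmul_eq_mul] at this
    rw [div_pow, Real.sq_sqrt (Nat.cast_nonneg T)]
    linarith
  -- The best comparator is the end of the diameter opposite to the sum of the mean gradients.
  obtain ⟨u, hu, hpay⟩ : ∃ u ∈ X, D / 2 * |∑ t ∈ Finset.range T, m t| =
      (∑ t ∈ Finset.range T, m t) * ((inner ℝ e a + inner ℝ e b) / 2 - inner ℝ e u) := by
    rcases le_total 0 (∑ t ∈ Finset.range T, m t) with h | h
    · exact ⟨b, hb', by rw [abs_of_nonneg h, ← heab]; ring⟩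
    · exact ⟨a, ha, by rw [abs_of_nonpos h, ← heab]; ring⟩
  obtain ⟨hint, hreg⟩ := SEA.regret_signLoss (M := M) (e := e) hX hb A hm1 T u
  refine ⟨Bool, inferInstance, SEA.signLoss M e, fun t => SEA.signLaw (m t), |M|,
    SEA.isLoss_signLoss M e X hX, fun t _ => ⟨SEA.assumptionA1_signLoss hX he,
      SEA.assumptionA2_signLoss (hm1 t) L, SEA.assumptionA3_signLoss⟩,
    by linarith [hσ'.1], by linarith [hS'.1], u, hu, hint, ?_⟩
  rw [hreg]
  rw [hpay, Finset.sum_mul, ← Finset.sum_add_distrib] at hgame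
  simp only [← mul_add, sub_add_sub_cancel] at hgame
  calc 1 / 32 * (D * (SEA.sigmaBar X (SEA.signLoss M e) (fun t => SEA.signLaw (m t)) T +
        SEA.driftBar X (SEA.signLoss M e) (fun t => SEA.signLaw (m t)) T) * √T)
      ≤ 1 / 32 * (D * (M + M) * √T) := by gcongr; exacts [hσ'.2, hS'.2]
    _ = M * (D / 2 / 2 * (√T / 4)) := by ring
    _ ≤ _ := by gcongr; exact (by gcongr : _ ≤ _).trans hgame
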